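/- Let $A=\mathbb{C}\langle u^{\pm1},v^{\pm1}\rangle$ be the group algebra over $\mathbb{C}$ of the free group on two generators $u,v$. Let $[A,A]\subset A$ be the linear span of all commutators $ab-ba$ with $a,b\in A$, and let $\pi:A\to A/[A,A]$ be the projection of vector spaces. There is exactly one linear map $⟦\cdot⟧_K:A\otimes A\to A\otimes A$ such that for all $a,b,c\in A$ $$⟦a\otimes bc⟧_K=⟦a\otimes b⟧_K(1\otimes c)+(b\otimes1)⟦a\otimes c⟧_K,\qquad ⟦ab\otimes c⟧_K=⟦a\otimes c⟧_K(b\otimes1)+(1\otimes a)⟦b\otimes c⟧_K$$ (products in the algebra $A\otimes A$) and $$⟦u\otimes v⟧_K=-vu\otimes1,\qquad ⟦v\otimes u⟧_K=uv\otimes1,\qquad ⟦u\otimes u⟧_K=⟦v\otimes v⟧_K=0.$$ Put $\{a,b\}_K=\mu(⟦a\otimes b⟧_K)$, where $\mu(x\otimes y)=xy$. Then: 1. $\{\cdot,\cdot\}_K$ is bilinear, and thus extends to a unique linear map $A\otimes A\to A$. 2. (a) $\{a,bc\}_K=\{a,b\}_Kc+b\{a,c\}_K$ for all $a,b,c\in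 A$; (b) $\{ab,c\}_K=\{ba,c\}_K$ for all $a,b,c\in A$. 3. $\{a,b\}_K+\{b,a\}_K\in[A,A]$ for all $a,b\in A$. 4. $\{H_1,\{H_2,x\}_K\}_K-\{H_2,\{H_1,x\}_K\}_K=\{\{H_1,H_2\}_K,x\}_K$ for all $H_1,H_2,x\in A$. Consequently $\{\cdot,\cdot\}_K$ descends to a left Loday bracket on $A/[A,A]\times A$. That is, there is a unique bilinear map $\{\cdot,\cdot\}_I:A/[A,A]\times A\to A$ with $\{\pi(a),b\}_I=\{a,b\}_K$ for all $a,b\in A$; it is a derivation in its second argument; and there is a bilinear map $\{\cdot,\cdot\}_{II}$ on $A/[A,A]$ with $\{f,\pi(a)\}_{II}=\pi(\{f,a\}_I)$ for all $f\in A/[A,A]$ and $a\in A$, which is skew-symmetric, satisfies $\{f,\{g,h\}_{II}\}_{II}+\{g,\{h,f\}_{II}\}_{II}+\{h,\{f,g\}_{II}\}_{II}=0$ for all $f,g,h\in A/[A,A]$, and satisfies $$\{f,\{g,x\}_I\}_I-\{g,\{f,x\}_I\}_I=\{\{f,g\}_{II},x\}_I\qquad (f,g\in A/[A,A],\ x\in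 A).$$ -/

import Mathlib

open scoped TensorProduct

namespace Kontsevich

noncomputable section

/-- The algebra `A = ℂ⟨u^{±1}, v^{±1}⟩`: the group algebra over `ℂ` of the free group on two
generators. -/
abbrev A : Type := MonoidAlgebra ℂ (FreeGroup (Fin 2))

/-- The two generators of the free group, as elements of `A`. -/
def gen (i : Fin 2) : A := MonoidAlgebra.of ℂ (FreeGroup (Fin 2)) (FreeGroup.of i)

/-- The generator `u`. -/
def u : A := gen 0

/-- The generator `v`. -/
def v : A := gen 1

/-- `D` satisfies the conditions that determine the modified double bracket: it is a linear map on
`A ⊗ A` (so it is bilinear as an operation on `A × A`), it satisfies the two double Leibniz rules,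
in which products are taken in the algebra `A ⊗ A`, and it has the prescribed values on the
generators. -/
structure IsDoubleBracket (D : A ⊗[ℂ] A →ₗ[ℂ] A ⊗[ℂ] A) : Prop where
  leibniz_right : ∀ a b c : A,
    D (a ⊗ₜ (b * c)) = D (a ⊗ₜ b) * ((1 : A) ⊗ₜ c) + (b ⊗ₜ (1 : A)) * D (a ⊗ₜ c)
  leibniz_left : ∀ a b c : A,
    D ((a * b) ⊗ₜ c) = D (a ⊗ₜ c) * (b ⊗ₜ (1 : A)) + ((1 : A) ⊗ₜ a) * D (b ⊗ₜ c)
  uv : D (u ⊗ₜ v) = -((v * u) ⊗ₜ (1 : A))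
  vu : D (v ⊗ₜ u) = (u * v) ⊗ₜ (1 : A)
  uu : D (u ⊗ₜ u) = 0
  vv : D (v ⊗ₜ v) = 0

/-! ### Existence and uniqueness of the double bracket -/

/-- Two linear maps with the same twisted Leibniz rule that agree on the generators are equal. -/
theorem twisted_unique {T : Type} [Ring T] [Algebra ℂ T] (f g : A →ₐ[ℂ] T)
    (d e : A →ₗ[ℂ] T) (hd : ∀ a b, d (a * b) = d a * g b + f a * d b)
    (he : ∀ a b, e (a * b) = e a * g b + f a * e b)
    (h : ∀ i, d (gen i) = e (gen i)) : d = e := by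
  obtain ⟨k, hk⟩ : ∃ k : A →ₗ[ℂ] T, k = d - e := ⟨_, rfl⟩
  have hkm : ∀ a b, k (a * b) = k a * g b + f a * k b := by
    intro a b
    simp only [hk, LinearMap.sub_apply, hd, he, sub_mul, mul_sub]
    abel
  have hk1 : k 1 = 0 := by
    have := hkm 1 1
    simpa using this
  have hkg : ∀ x : FreeGroup (Fin 2), k (MonoidAlgebra.of ℂ _ x) = 0 := by
    intro x
    induction x using FreeGroup.induction_on with
    | C1 => rw [map_one, hk1]
    | of i =>
      have h0 := h i
      rw [gen] at h0
      rw [hk, LinearMap.sub_apply, h0, sub_self]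
    | inv_of i hi =>
      have h1 := hkm (MonoidAlgebra.of ℂ _ (FreeGroup.of i)⁻¹)
        (MonoidAlgebra.of ℂ _ (FreeGroup.of i))
      rw [← map_mul, inv_mul_cancel, map_one, hk1, hi, mul_zero, add_zero] at h1
      have h2 : g (MonoidAlgebra.of ℂ _ (FreeGroup.of i)) *
          g (MonoidAlgebra.of ℂ _ (FreeGroup.of i)⁻¹) = 1 := by
        rw [← map_mul, ← map_mul, mul_inv_cancel, map_one, map_one]
      have h3 := congrArg (· * g (MonoidAlgebra.of ℂ _ (FreeGroup.of i)⁻¹)) h1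
      simp only [zero_mul, mul_assoc, h2, mul_one] at h3
      exact h3.symm
    | mul x y hx hy => rw [map_mul, hkm, hx, hy, zero_mul, mul_zero, add_zero]
  have hk0 : ∀ a, k a = 0 := by
    intro a
    induction a using MonoidAlgebra.induction_on with
    | of x => exact hkg x
    | add a b ha hb => rw [map_add, ha, hb, add_zero]
    | smul r a ha => rw [map_smul, ha, smul_zero]
  refine LinearMap.ext fun a => ?_
  have h4 := hk0 a
  rwa [hk, LinearMap.sub_apply, sub_eq_zero] at h4

/-- There is a linear map with a given twisted Leibniz rule and given values on the generators. -/
theorem twisted_exists {T : Type} [Ring T] [Algebra ℂ T] (f g : A →ₐ[ℂ] T) (w : Fin 2 → T) :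
    ∃ d : A →ₗ[ℂ] T, (∀ a b, d (a * b) = d a * g b + f a * d b) ∧ ∀ i, d (gen i) = w i := by
  let inv (i : Fin 2) : A := MonoidAlgebra.of ℂ (FreeGroup (Fin 2)) (FreeGroup.of i)⁻¹
  have hgi : ∀ i, gen i * inv i = 1 := fun i => by
    simp only [gen, inv]
    rw [← map_mul, mul_inv_cancel, map_one]
  have hig : ∀ i, inv i * gen i = 1 := fun i => by
    simp only [gen, inv]
    rw [← map_mul, inv_mul_cancel, map_one]
  have f1 : ∀ i, f (gen i) * f (inv i) = 1 := fun i => by rw [← map_mul, hgi, map_one]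
  have f2 : ∀ i, f (inv i) * f (gen i) = 1 := fun i => by rw [← map_mul, hig, map_one]
  have g1 : ∀ i, g (gen i) * g (inv i) = 1 := fun i => by rw [← map_mul, hgi, map_one]
  have g2 : ∀ i, g (inv i) * g (gen i) = 1 := fun i => by rw [← map_mul, hig, map_one]
  let U (i : Fin 2) : (Matrix (Fin 2) (Fin 2) T)ˣ :=
    { val := !![f (gen i), w i; 0, g (gen i)]
      inv := !![f (inv i), -(f (inv i) * w i * g (inv i)); 0, g (inv i)]
      val_inv := by
        simp [Matrix.one_fin_two, f1, g1, ← mul_assoc]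
      inv_val := by
        simp [Matrix.one_fin_two, f2, g2, mul_assoc] }
  let Φ : A →ₐ[ℂ] Matrix (Fin 2) (Fin 2) T :=
    MonoidAlgebra.lift ℂ _ _ ((Units.coeHom _).comp (FreeGroup.lift U))
  have hΦ : ∀ i, Φ (gen i) = !![f (gen i), w i; 0, g (gen i)] := by
    intro i
    simp [Φ, gen, U]
  have hΦi : ∀ i, Φ (inv i) =
      !![f (inv i), -(f (inv i) * w i * g (inv i)); 0, g (inv i)] := by
    intro i
    simp only [Φ, inv, MonoidAlgebra.lift_of, MonoidHom.comp_apply, map_inv, FreeGroup.lift_apply_of]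
    rfl
  have key : ∀ a, Φ a 0 0 = f a ∧ Φ a 1 0 = 0 ∧ Φ a 1 1 = g a := by
    intro a
    induction a using MonoidAlgebra.induction_on with
    | of x =>
      induction x using FreeGroup.induction_on with
      | C1 => simp only [map_one]; simp
      | of i =>
        have := hΦ i
        simp only [gen] at this
        rw [this]; simp
      | inv_of i hi =>
        have := hΦi i
        simp only [inv] at this
        rw [this]; simp
      | mul x y hx hy =>
        obtain ⟨x1, x2, x3⟩ := hx
        obtain ⟨y1, y2, y3⟩ := hy
        simp only [map_mul, Matrix.mul_apply, Fin.sum_univ_two, x1, x2, x3, y1, y2, y3]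
        simp
    | add a b ha hb =>
      obtain ⟨x1, x2, x3⟩ := ha
      obtain ⟨y1, y2, y3⟩ := hb
      simp [x1, x2, x3, y1, y2, y3]
    | smul r a ha =>
      obtain ⟨x1, x2, x3⟩ := ha
      simp [x1, x2, x3]
  refine ⟨{ toFun := fun a => Φ a 0 1, map_add' := ?_, map_smul' := ?_ }, ?_, ?_⟩
  · intro a b; simp
  · intro r a; simp
  · intro a b
    simp only [LinearMap.coe_mk, AddHom.coe_mk, map_mul, Matrix.mul_apply, Fin.sum_univ_two,
      (key a).1, (key b).2.2]
    abel
  · intro i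
    simp [hΦ]

/-- The values of the double bracket on the generators. -/
def genValue (i j : Fin 2) : A ⊗[ℂ] A :=
  if i = 0 ∧ j = 1 then -((v * u) ⊗ₜ (1 : A))
  else if i = 1 ∧ j = 0 then (u * v) ⊗ₜ (1 : A)
  else 0

theorem IsDoubleBracket.gen_gen {D : A ⊗[ℂ] A →ₗ[ℂ] A ⊗[ℂ] A} (h : IsDoubleBracket D)
    (i j : Fin 2) : D (gen i ⊗ₜ gen j) = genValue i j := by
  have h1 := h.uv
  have h2 := h.vu
  have h3 := h.uu
  have h4 := h.vv
  simp only [u, v] at h1 h2 h3 h4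
  fin_cases i <;> fin_cases j <;> simp [genValue, u, v, h1, h2, h3, h4]

theorem exists_isDoubleBracket : ∃ D, IsDoubleBracket D := by
  let l : A →ₐ[ℂ] A ⊗[ℂ] A := Algebra.TensorProduct.includeLeft
  let r : A →ₐ[ℂ] A ⊗[ℂ] A := Algebra.TensorProduct.includeRight
  have hl : ∀ a, l a = a ⊗ₜ (1 : A) := fun _ => rfl
  have hr : ∀ a, r a = (1 : A) ⊗ₜ a := fun _ => rfl
  have hlr : ∀ a b, l a * r b = r b * l a := fun a b => by
    simp [hl, hr]
  choose E hE hEg using fun i => twisted_exists l r (genValue i)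
  choose F hF hFg using fun c => twisted_exists r l (fun i => E i c)
  have hadd : ∀ b c, F (b + c) = F b + F c := fun b c =>
    twisted_unique r l _ _ (hF _)
      (fun x y => by simp only [LinearMap.add_apply, hF, add_mul, mul_add]; abel)
      (fun i => by simp [hFg])
  have hsmul : ∀ (s : ℂ) c, F (s • c) = s • F c := fun s c =>
    twisted_unique r l _ _ (hF _)
      (fun x y => by simp only [LinearMap.smul_apply, hF, smul_add, smul_mul_assoc, mul_smul_comm])
      (fun i => by simp [hFg])
  have hmul : ∀ b c, F (b * c) =
      (LinearMap.mulRight ℂ (r c)).comp (F b) + (LinearMap.mulLeft ℂ (l b)).comp (F c) :=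
    fun b c => twisted_unique r l _ _ (hF _)
      (fun x y => by
        simp only [LinearMap.add_apply, LinearMap.comp_apply, LinearMap.mulRight_apply,
          LinearMap.mulLeft_apply, hF, add_mul, mul_add, mul_assoc, hlr y c]
        simp only [← mul_assoc, hlr b x]
        abel)
      (fun i => by simp [hFg, hE])
  let B : A →ₗ[ℂ] A →ₗ[ℂ] A ⊗[ℂ] A := { toFun := F, map_add' := hadd, map_smul' := hsmul }
  have hB : ∀ a c, TensorProduct.lift B.flip (a ⊗ₜ c) = F c a := fun _ _ => rfl
  refine ⟨TensorProduct.lift B.flip, ?_, ?_, ?_, ?_, ?_, ?_⟩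
  · intro a b c
    simp only [hB, hmul]
    rfl
  · intro a b c
    simp only [hB, hF, hl, hr]
  all_goals
    simp [hB, u, v, hFg, hEg, genValue]

theorem IsDoubleBracket.unique {D D' : A ⊗[ℂ] A →ₗ[ℂ] A ⊗[ℂ] A} (h : IsDoubleBracket D)
    (h' : IsDoubleBracket D') : D = D' := by
  let l : A →ₐ[ℂ] A ⊗[ℂ] A := Algebra.TensorProduct.includeLeft
  let r : A →ₐ[ℂ] A ⊗[ℂ] A := Algebra.TensorProduct.includeRight
  have h1 : ∀ i, (TensorProduct.curry D) (gen i) = (TensorProduct.curry D') (gen i) := fun i =>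
    twisted_unique l r _ _ (fun a b => h.leibniz_right _ a b) (fun a b => h'.leibniz_right _ a b)
      (fun j => by simp only [TensorProduct.curry_apply, h.gen_gen, h'.gen_gen])
  have h2 : ∀ c, (TensorProduct.curry D).flip c = (TensorProduct.curry D').flip c := fun c =>
    twisted_unique r l _ _ (fun a b => h.leibniz_left a b c) (fun a b => h'.leibniz_left a b c)
      (fun i => by simp only [LinearMap.flip_apply, h1])
  refine TensorProduct.ext' fun a c => ?_
  exact LinearMap.congr_fun (h2 c) a

/-! ### The objects of the statement -/

/-- The modified double bracket `⟦_⟧_K : A ⊗ A → A ⊗ A`: the linear map with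
`IsDoubleBracket`, which exists and is unique by the facts above. -/
def doubleBracket : A ⊗[ℂ] A →ₗ[ℂ] A ⊗[ℂ] A := Classical.choose exists_isDoubleBracket

theorem doubleBracket_spec : IsDoubleBracket doubleBracket :=
  Classical.choose_spec exists_isDoubleBracket

/-- The bracket `{a, b}_K = μ(⟦a ⊗ b⟧_K)`, where `μ(x ⊗ y) = x * y`. -/
def bracket (a b : A) : A := LinearMap.mul' ℂ A (doubleBracket (a ⊗ₜ b))

/-- The commutant `[R, R]`: the linear span of all commutators (not an ideal). -/
def commutant (R : Type) [Ring R] [Algebra ℂ R] : Submodule ℂ R :=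
  Submodule.span ℂ {x | ∃ a b : R, x = a * b - b * a}

/-- The cyclic space `R / [R, R]`, a quotient of vector spaces. -/
abbrev CyclicSpace (R : Type) [Ring R] [Algebra ℂ R] : Type := R ⧸ commutant R

/-- The projection `π : R → R / [R, R]`. -/
def cyclicProj (R : Type) [Ring R] [Algebra ℂ R] : R →ₗ[ℂ] CyclicSpace R := (commutant R).mkQ

/-- A bilinear map `{_,_}_I : R/[R,R] × R → R` is a left Loday bracket if it is a derivation in its
second argument, and if it induces on the second argument modulo `[R,R]` a bilinear map `{_,_}_II`
on `R/[R,R]` that is skew-symmetric, satisfies the Jacobi identity, and for which `f ↦ {f, _}_I`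
turns brackets into commutators. -/
structure IsLeftLodayBracket (R : Type) [Ring R] [Algebra ℂ R]
    (B : CyclicSpace R →ₗ[ℂ] R →ₗ[ℂ] R) : Prop where
  leibniz : ∀ (f : CyclicSpace R) (a b : R), B f (a * b) = B f a * b + a * B f b
  exists_cyclic : ∃ C : CyclicSpace R →ₗ[ℂ] CyclicSpace R →ₗ[ℂ] CyclicSpace R,
    (∀ (f : CyclicSpace R) (a : R), C f (cyclicProj R a) = cyclicProj R (B f a)) ∧
    (∀ f g : CyclicSpace R, C f g = -C g f) ∧
    (∀ f g h : CyclicSpace R, C f (C g h) + C g (C h f) + C h (C f g) = 0) ∧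
    (∀ (f g : CyclicSpace R) (x : R), B f (B g x) - B g (B f x) = B (C f g) x)

end

end Kontsevich

namespace Kontsevich

noncomputable section

/-! ### The cyclic projection and the nondegenerate trace form -/

/-! Write X_h for the derivation {h, ·}_K; the Leibniz rule and the cyclic invariance in `h` come
from applying μ to the two double Leibniz rules. The rest is noncommutative symplectic geometry,
with the pairing tr(ab) in place of integration. This pairing is nondegenerate (`eq_of_tr_mul_eq`),
and a derivation is determined by its values on u and v.

The values of X_h on v and u give, up to sign and a left factor, elements `logU h` and `logV h`. By
`tr_deriv`, their conjugates are the components of the differential of tr h, so X_h is a Hamiltonian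
field. Inner derivations do not change tr h, which forces the moment identity `moment`. With the
conjugation invariance of the trace, it yields skew-symmetry of tr {f, g}.

For the Jacobi identity, tr d{f, g} is computed for an arbitrary derivation d in two ways: from d
X_f = [d, X_f] + X_f d (`tr_deriv_ham_expand`), and from the formula for tr {f, g} (`tr_deriv_ham`).
Comparing them identifies the differential of {f, g} with the components of [X_f, X_g];
nondegeneracy then gives [X_f, X_g] = X_{f,g}. Descent to the quotient is formal. -/

/-- The projection `A → A / [A, A]`. -/
abbrev tr : A →ₗ[ℂ] CyclicSpace A := cyclicProj A

theorem tr_mul_comm (a b : A) : tr (a * b) = tr (b * a) := by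
  rw [← sub_eq_zero, ← map_sub]
  exact (Submodule.Quotient.mk_eq_zero _).2 (Submodule.subset_span ⟨a, b, rfl⟩)

theorem tr_eq_zero_iff (a : A) : tr a = 0 ↔ a ∈ commutant A :=
  Submodule.Quotient.mk_eq_zero _

theorem tr_surjective : Function.Surjective tr := Submodule.mkQ_surjective _

/-- The coefficient of the identity. -/
def coeffOne : A →ₗ[ℂ] ℂ where
  toFun a := a.coeff 1
  map_add' _ _ := rfl
  map_smul' _ _ := rfl

theorem coeffOne_apply (a : A) : coeffOne a = a.coeff 1 := rfl

theorem coeffOne_mul_of (a : A) (x : FreeGroup (Fin 2)) :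
    coeffOne (a * MonoidAlgebra.of ℂ _ x) = a.coeff x⁻¹ := by
  simp [coeffOne_apply]

theorem coeffOne_of_mul (a : A) (x : FreeGroup (Fin 2)) :
    coeffOne (MonoidAlgebra.of ℂ _ x * a) = a.coeff x⁻¹ := by
  simp [coeffOne_apply]

theorem coeffOne_mul_comm (a b : A) : coeffOne (a * b) = coeffOne (b * a) := by
  induction b using MonoidAlgebra.induction_on with
  | of x => rw [coeffOne_mul_of, coeffOne_of_mul]
  | add b c hb hc => rw [mul_add, add_mul, map_add, map_add, hb, hc]
  | smul r b hb => rw [mul_smul_comm, smul_mul_assoc, map_smul, map_smul, hb]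

theorem coeffOne_eq_zero_of_tr_eq_zero {a : A} (h : tr a = 0) : coeffOne a = 0 := by
  have hle : commutant A ≤ LinearMap.ker coeffOne := by
    refine Submodule.span_le.2 ?_
    rintro _ ⟨x, y, rfl⟩
    simp [coeffOne_mul_comm x y]
  exact hle ((tr_eq_zero_iff a).1 h)

/-- The coefficient of 1 is a trace, so it factors through `tr`; testing against `x⁻¹` recovers the
coefficient at `x`. -/
theorem eq_of_tr_mul_eq {a b : A} (h : ∀ c, tr (a * c) = tr (b * c)) : a = b := by
  rw [← sub_eq_zero]
  refine MonoidAlgebra.coeff_injective (Finsupp.ext fun x => ?_)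
  have h1 : tr ((a - b) * MonoidAlgebra.of ℂ _ x⁻¹) = 0 := by
    rw [sub_mul, map_sub, h, sub_self]
  have h2 := coeffOne_eq_zero_of_tr_eq_zero h1
  rw [coeffOne_mul_of, inv_inv] at h2
  simpa using h2

/-! ### Derivations of `A` -/

/-- The inverse of `u`. -/
def uInv : A := MonoidAlgebra.of ℂ (FreeGroup (Fin 2)) (FreeGroup.of 0)⁻¹

/-- The inverse of `v`. -/
def vInv : A := MonoidAlgebra.of ℂ (FreeGroup (Fin 2)) (FreeGroup.of 1)⁻¹

theorem u_mul_uInv : u * uInv = 1 := by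
  rw [u, gen, uInv, ← map_mul, mul_inv_cancel, map_one]

theorem uInv_mul_u : uInv * u = 1 := by
  rw [u, gen, uInv, ← map_mul, inv_mul_cancel, map_one]

theorem v_mul_vInv : v * vInv = 1 := by
  rw [v, gen, vInv, ← map_mul, mul_inv_cancel, map_one]

theorem vInv_mul_v : vInv * v = 1 := by
  rw [v, gen, vInv, ← map_mul, inv_mul_cancel, map_one]

theorem u_mul_uInv_mul (a : A) : u * (uInv * a) = a := by rw [← mul_assoc, u_mul_uInv, one_mul]

theorem uInv_mul_u_mul (a : A) : uInv * (u * a) = a := by rw [← mul_assoc, uInv_mul_u, one_mul]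

theorem v_mul_vInv_mul (a : A) : v * (vInv * a) = a := by rw [← mul_assoc, v_mul_vInv, one_mul]

theorem vInv_mul_v_mul (a : A) : vInv * (v * a) = a := by rw [← mul_assoc, vInv_mul_v, one_mul]

/-- A linear endomorphism of `A` that satisfies the Leibniz rule. -/
def IsDeriv (d : A →ₗ[ℂ] A) : Prop := ∀ a b, d (a * b) = d a * b + a * d b

theorem IsDeriv.ext {d e : A →ₗ[ℂ] A} (hd : IsDeriv d) (he : IsDeriv e) (hu : d u = e u)
    (hv : d v = e v) : d = e :=
  twisted_unique (AlgHom.id ℂ A) (AlgHom.id ℂ A) d e hd he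
    (fun i => by fin_cases i; exacts [hu, hv])

theorem exists_isDeriv (a b : A) : ∃ d, IsDeriv d ∧ d u = a ∧ d v = b := by
  obtain ⟨d, hd, h⟩ := twisted_exists (AlgHom.id ℂ A) (AlgHom.id ℂ A) ![a, b]
  exact ⟨d, hd, h 0, h 1⟩

theorem IsDeriv.commutator {d e : A →ₗ[ℂ] A} (hd : IsDeriv d) (he : IsDeriv e) :
    IsDeriv (d ∘ₗ e - e ∘ₗ d) := by
  intro a b
  simp only [LinearMap.sub_apply, LinearMap.comp_apply, hd _ _, he _ _, map_add]
  noncomm_ring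

/-- A derivation sends xy - yx to [dx, y] + [x, dy], so it preserves the commutant. -/
theorem IsDeriv.tr_congr {d : A →ₗ[ℂ] A} (hd : IsDeriv d) {a b : A} (h : tr a = tr b) :
    tr (d a) = tr (d b) := by
  have hle : commutant A ≤ LinearMap.ker (tr ∘ₗ d) := by
    refine Submodule.span_le.2 ?_
    rintro _ ⟨x, y, rfl⟩
    simp only [SetLike.mem_coe, LinearMap.mem_ker, LinearMap.comp_apply, map_sub, hd _ _, map_add]
    rw [tr_mul_comm (d x) y, tr_mul_comm x (d y)]
    abel
  have h1 : tr (a - b) = 0 := by rw [map_sub, h, sub_self]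
  have h2 : tr (d (a - b)) = 0 := hle ((tr_eq_zero_iff _).1 h1)
  rwa [map_sub, map_sub, sub_eq_zero] at h2

/-! ### Hamiltonian derivations -/

/-- The bracket as a bilinear map. -/
def ham : A →ₗ[ℂ] A →ₗ[ℂ] A :=
  (TensorProduct.curry doubleBracket).compr₂ (LinearMap.mul' ℂ A)

theorem ham_apply (a b : A) : ham a b = bracket a b := rfl

theorem mul'_doubleBracket (a b : A) :
    LinearMap.mul' ℂ A (doubleBracket (a ⊗ₜ b)) = ham a b := rfl

theorem mul'_mul_one_tmul (t : A ⊗[ℂ] A) (c : A) :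
    LinearMap.mul' ℂ A (t * ((1 : A) ⊗ₜ c)) = LinearMap.mul' ℂ A t * c := by
  induction t using TensorProduct.induction_on with
  | zero => simp
  | tmul x y => simp [mul_assoc]
  | add s t hs ht => simp only [add_mul, map_add, hs, ht]

theorem mul'_tmul_one_mul (t : A ⊗[ℂ] A) (c : A) :
    LinearMap.mul' ℂ A ((c ⊗ₜ (1 : A)) * t) = c * LinearMap.mul' ℂ A t := by
  induction t using TensorProduct.induction_on with
  | zero => simp
  | tmul x y => simp [mul_assoc]
  | add s t hs ht => simp only [mul_add, map_add, hs, ht]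

/-- Both sides insert `c` between the two tensor factors. This makes the left Leibniz rule symmetric
after μ, hence `ham_mul_comm`. -/
theorem mul'_mul_tmul_one (t : A ⊗[ℂ] A) (c : A) :
    LinearMap.mul' ℂ A (t * (c ⊗ₜ (1 : A))) = LinearMap.mul' ℂ A (((1 : A) ⊗ₜ c) * t) := by
  induction t using TensorProduct.induction_on with
  | zero => simp
  | tmul x y => simp [mul_assoc]
  | add s t hs ht => simp only [add_mul, mul_add, map_add, hs, ht]

theorem isDeriv_ham (h : A) : IsDeriv (ham h) := by
  intro a b
  simp only [ham_apply, bracket, doubleBracket_spec.leibniz_right, map_add, mul'_mul_one_tmul,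
    mul'_tmul_one_mul]

theorem ham_mul_comm (a b : A) : ham (a * b) = ham (b * a) := by
  refine LinearMap.ext fun c => ?_
  simp only [ham_apply, bracket, doubleBracket_spec.leibniz_left, map_add, mul'_mul_tmul_one]
  abel

/-- The logarithmic cyclic derivative with respect to `u`. -/
def logU (h : A) : A := -(vInv * ham h v)

/-- The logarithmic cyclic derivative with respect to `v`. -/
def logV (h : A) : A := uInv * ham h u

/-- The conjugate of `logU h` by `u`. -/
def logU' (h : A) : A := uInv * logU h * u

/-- The conjugate of `logV h` by `v`. -/
def logV' (h : A) : A := vInv * logV h * v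

theorem ham_u (h : A) : ham h u = u * logV h := by
  rw [logV, u_mul_uInv_mul]

theorem ham_v (h : A) : ham h v = v * -logU h := by
  rw [logU, neg_neg, v_mul_vInv_mul]

/-- Inserting `z` in the middle of the flipped tensor. -/
def sandwich (z : A) : A ⊗[ℂ] A →ₗ[ℂ] A :=
  LinearMap.mul' ℂ A ∘ₗ LinearMap.lTensor A (LinearMap.mulLeft ℂ z) ∘ₗ
    (TensorProduct.comm ℂ A A).toLinearMap

@[simp] theorem sandwich_tmul (z x y : A) : sandwich z (x ⊗ₜ y) = y * (z * x) := rfl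

theorem sandwich_mul_tmul_one (z c : A) (t : A ⊗[ℂ] A) :
    sandwich z (t * (c ⊗ₜ (1 : A))) = sandwich z t * c := by
  induction t using TensorProduct.induction_on with
  | zero => simp
  | tmul x y => simp [mul_assoc]
  | add s t hs ht => simp only [add_mul, map_add, hs, ht]

theorem sandwich_one_tmul_mul (z c : A) (t : A ⊗[ℂ] A) :
    sandwich z (((1 : A) ⊗ₜ c) * t) = c * sandwich z t := by
  induction t using TensorProduct.induction_on with
  | zero => simp
  | tmul x y => simp [mul_assoc]
  | add s t hs ht => simp only [mul_add, map_add, hs, ht]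

theorem tr_sandwich (z : A) (t : A ⊗[ℂ] A) :
    tr (sandwich z t) = tr (z * LinearMap.mul' ℂ A t) := by
  induction t using TensorProduct.induction_on with
  | zero => simp
  | tmul x y => rw [sandwich_tmul, tr_mul_comm, LinearMap.mul'_apply, mul_assoc]
  | add s t hs ht => simp only [mul_add, map_add, hs, ht]

/-- Flipping the factors turns the inner actions in the left Leibniz rule into outer
multiplications, so the double bracket becomes an ordinary derivation of its first argument. -/
theorem isDeriv_sandwich (z c : A) :
    IsDeriv (sandwich z ∘ₗ (TensorProduct.curry doubleBracket).flip c) := by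
  intro a b
  simp only [LinearMap.comp_apply, LinearMap.flip_apply, TensorProduct.curry_apply,
    doubleBracket_spec.leibniz_left, map_add, sandwich_mul_tmul_one, sandwich_one_tmul_mul]

/-- The differential of the class of `h` in the direction of a derivation. -/
theorem tr_deriv {d : A →ₗ[ℂ] A} (hd : IsDeriv d) {a b : A} (hu : d u = u * a) (hv : d v = v * b)
    (h : A) : tr (d h) = tr (logU' h * a) + tr (logV' h * b) := by
  -- Every derivation arises from the double bracket: the two middle factors are solved from the
  -- values ⟦u ⊗ v⟧ = -vu ⊗ 1 and ⟦v ⊗ u⟧ = uv ⊗ 1.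
  have key : d = sandwich (-(u * a * uInv * vInv)) ∘ₗ (TensorProduct.curry doubleBracket).flip v +
      sandwich (v * b * vInv * uInv) ∘ₗ (TensorProduct.curry doubleBracket).flip u := by
    refine hd.ext ?_ ?_ ?_
    · intro x y
      simp only [LinearMap.add_apply, isDeriv_sandwich _ _ x y]
      noncomm_ring
    · simp [doubleBracket_spec.uv, doubleBracket_spec.uu, hu, mul_assoc, vInv_mul_v_mul,
        uInv_mul_u]
    · simp [doubleBracket_spec.vu, doubleBracket_spec.vv, hv, mul_assoc, vInv_mul_v,
        uInv_mul_u_mul]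
  rw [key, LinearMap.add_apply, map_add]
  simp only [LinearMap.comp_apply, LinearMap.flip_apply, TensorProduct.curry_apply, tr_sandwich]
  simp only [mul'_doubleBracket, ham_u, ham_v, logU', logV']
  congr 1
  · rw [tr_mul_comm (uInv * logU h * u) a]
    simp only [mul_assoc, mul_neg, neg_mul, neg_neg, vInv_mul_v_mul]
    rw [tr_mul_comm]
    simp only [mul_assoc]
  · rw [tr_mul_comm (vInv * logV h * v) b]
    simp only [mul_assoc, uInv_mul_u_mul]
    rw [tr_mul_comm]
    simp only [mul_assoc]

/-! ### The moment identity and skew-symmetry -/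

theorem moment (h : A) : logU h + logV h = logU' h + logV' h := by
  refine eq_of_tr_mul_eq fun z => ?_
  have hd : IsDeriv (LinearMap.mulRight ℂ z - LinearMap.mulLeft ℂ z) := by
    intro a b
    simp only [LinearMap.sub_apply, LinearMap.mulRight_apply, LinearMap.mulLeft_apply]
    noncomm_ring
  -- The inner derivation x ↦ xz - zx has these components, and it maps `h` into the commutant.
  have h1 := tr_deriv hd (a := z - uInv * z * u) (b := z - vInv * z * v)
    (by simp [mul_sub, mul_assoc, u_mul_uInv_mul]) (by simp [mul_sub, mul_assoc, v_mul_vInv_mul]) h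
  have h2 : tr (logU' h * (uInv * z * u)) = tr (logU h * z) := by
    simp only [logU', mul_assoc, u_mul_uInv_mul]
    rw [tr_mul_comm]
    simp only [mul_assoc, u_mul_uInv, mul_one]
  have h3 : tr (logV' h * (vInv * z * v)) = tr (logV h * z) := by
    simp only [logV', mul_assoc, v_mul_vInv_mul]
    rw [tr_mul_comm]
    simp only [mul_assoc, v_mul_vInv, mul_one]
  simp only [LinearMap.sub_apply, LinearMap.mulRight_apply, LinearMap.mulLeft_apply, mul_sub,
    map_sub, h2, h3, tr_mul_comm z h, sub_self] at h1
  simp only [add_mul, map_add]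
  linear_combination (norm := module) h1

theorem tr_ham (f g : A) :
    tr (ham f g) = tr (logU' g * logV f) - tr (logV' g * logU f) := by
  rw [tr_deriv (isDeriv_ham f) (ham_u f) (ham_v f) g, mul_neg, map_neg, sub_eq_add_neg]

theorem tr_conj_u (a b : A) : tr (uInv * a * u * (uInv * b * u)) = tr (a * b) := by
  simp only [mul_assoc, u_mul_uInv_mul]
  rw [tr_mul_comm]
  simp only [mul_assoc, u_mul_uInv, mul_one]

theorem tr_conj_v (a b : A) : tr (vInv * a * v * (vInv * b * v)) = tr (a * b) := by
  simp only [mul_assoc, v_mul_vInv_mul]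
  rw [tr_mul_comm]
  simp only [mul_assoc, v_mul_vInv, mul_one]

theorem tr_mul_congr {a a' : A} (h : a = a') (b : A) : tr (a * b) = tr (a' * b) := by rw [h]

theorem tr_ham_skew (f g : A) : tr (ham f g) = -tr (ham g f) := by
  have e1 := tr_mul_congr (moment g) (logV f)
  have e2 := tr_mul_congr (moment f) (logV g)
  have e3 := tr_mul_congr (moment g) (logU f + logV f)
  -- Only the right side changes: `e3` now equates the unprimed and primed products of the two
  -- moments, whose UU and VV terms cancel by `c1` and `c2`.
  nth_rewrite 2 [moment f] at e3
  have e4 := tr_mul_congr (moment f) (logV' g)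
  have e5 := tr_mul_congr (moment g) (logV' f)
  have c1 : tr (logU' g * logU' f) = tr (logU g * logU f) := tr_conj_u _ _
  have c2 : tr (logV' g * logV' f) = tr (logV g * logV f) := tr_conj_v _ _
  rw [tr_ham, tr_ham]
  simp only [add_mul, mul_add, map_add] at e1 e2 e3 e4 e5
  rw [tr_mul_comm (logU f), tr_mul_comm (logV f), tr_mul_comm (logU' f),
    tr_mul_comm (logV' f)] at e2 e4
  rw [tr_mul_comm (logU' f), tr_mul_comm (logV' f)]
  linear_combination (norm := module) e3 + c1 - c2 - e1 - e2 - e4 - e5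

/-! ### The Jacobi identity -/

/-- Apply `d` to w(w'xw) = xw and solve for the unknown term; the value of `d` on `w'` is never
needed. -/
theorem IsDeriv.map_conj {d : A →ₗ[ℂ] A} (hd : IsDeriv d) {w w' a : A} (h1 : w * w' = 1)
    (h2 : w' * w = 1) (hw : d w = w * a) (x : A) :
    d (w' * x * w) = w' * d x * w + (w' * x * w * a - a * (w' * x * w)) := by
  have e1 := hd w (w' * x * w)
  have e2 := hd x w
  rw [← mul_assoc w, ← mul_assoc w, h1, one_mul, e2, hw] at e1
  have e3 := congrArg (w' * ·) e1
  simp only [mul_add, ← mul_assoc, h2, one_mul] at e3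
  simp only [← mul_assoc]
  rw [add_sub_assoc', e3]
  abel

theorem IsDeriv.map_logU' {d : A →ₗ[ℂ] A} (hd : IsDeriv d) {a : A} (hu : d u = u * a) (h : A) :
    d (logU' h) = uInv * d (logU h) * u + (logU' h * a - a * logU' h) :=
  hd.map_conj u_mul_uInv uInv_mul_u hu _

theorem IsDeriv.map_logV' {d : A →ₗ[ℂ] A} (hd : IsDeriv d) {b : A} (hv : d v = v * b) (h : A) :
    d (logV' h) = vInv * d (logV h) * v + (logV' h * b - b * logV' h) :=
  hd.map_conj v_mul_vInv vInv_mul_v hv _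

theorem tr_mul_commutator (x y a : A) :
    tr ((y * a - a * y) * x) = tr (x * y * a) - tr (y * x * a) := by
  rw [sub_mul, map_sub, tr_mul_comm (y * a) x, mul_assoc a, tr_mul_comm a, mul_assoc x]

theorem tr_commutator_mul (x y a : A) :
    tr (y * (a * x - x * a)) = tr (x * y * a) - tr (y * x * a) := by
  rw [mul_sub, map_sub, ← mul_assoc, tr_mul_comm (y * a) x, ← mul_assoc, ← mul_assoc]

/-- The part of the derivative of `tr (ham f g)` in which only the logarithmic derivatives of `g`
are differentiated. -/
theorem tr_deriv_ham_aux {d : A →ₗ[ℂ] A} (hd : IsDeriv d) {a b : A} (hu : d u = u * a)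
    (hv : d v = v * b) (f g : A) :
    tr (d (logU' g) * logV f) - tr (d (logV' g) * logU f) =
      tr (logU' f * logU' g * a) - tr (logU' g * logU' f * a) -
        (tr (logV' f * logV' g * b) - tr (logV' g * logV' f * b)) -
        tr (logU' f * d (logV g)) + tr (logV' f * d (logU g)) := by
  have eu : tr (logU' f * logU' g * a) - tr (logU' g * logU' f * a) =
      tr (d (logU' g) * logU' f) - tr (d (logU g) * logU f) := by
    have c : tr (uInv * d (logU g) * u * logU' f) = tr (d (logU g) * logU f) := tr_conj_u _ _
    rw [← tr_mul_commutator, ← c, hd.map_logU' hu, add_mul, map_add]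
    abel
  have ev : tr (logV' f * logV' g * b) - tr (logV' g * logV' f * b) =
      tr (d (logV' g) * logV' f) - tr (d (logV g) * logV f) := by
    have c : tr (vInv * d (logV g) * v * logV' f) = tr (d (logV g) * logV f) := tr_conj_v _ _
    rw [← tr_mul_commutator, ← c, hd.map_logV' hv, add_mul, map_add]
    abel
  -- The cubic terms are now expressed as the failure of `d` to commute with conjugation. What is
  -- left follows from the moment identity for `f` and the differentiated one for `g`.
  have m := congrArg d (moment g)
  simp only [map_add] at m
  have e1 := tr_mul_congr m (logV' f - logU f)
  have e2 := congrArg (fun x => tr (d (logV g) * x)) (moment f)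
  have e3 := congrArg (fun x => tr (d (logU' g) * x)) (moment f)
  simp only [add_mul, mul_add, mul_sub, map_add, map_sub] at e1 e2 e3
  rw [eu, ev, tr_mul_comm (logU' f), tr_mul_comm (logV' f)]
  linear_combination (norm := module) e3 - e1 - e2

theorem tr_deriv_ham_expand {d : A →ₗ[ℂ] A} (hd : IsDeriv d) {a b : A} (hu : d u = u * a)
    (hv : d v = v * b) (f g : A) :
    tr (d (ham f g)) = tr (ham f (logU' g) * a) + tr (ham f (logV' g) * b) +
      (tr (logV f * logU' g * a) - tr (logU' g * logV f * a)) + tr (logU' g * d (logV f)) -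
      (tr (logU f * logV' g * b) - tr (logV' g * logU f * b)) - tr (logV' g * d (logU f)) := by
  have hX := isDeriv_ham f
  -- These are the components of [d, X_f], read off from its values on u and v.
  have h1 := tr_deriv (hd.commutator hX)
    (a := a * logV f - logV f * a + d (logV f) - ham f a)
    (b := -(b * logU f - logU f * b) - d (logU f) - ham f b)
    (by
      simp only [LinearMap.sub_apply, LinearMap.comp_apply, ham_u, hu, hd _ _, hX _ _]
      noncomm_ring)
    (by
      simp only [LinearMap.sub_apply, LinearMap.comp_apply, ham_v, hv, hd _ _, hX _ _, map_neg]
      noncomm_ring) g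
  have h2 : tr (ham f (d g)) = tr (ham f (logU' g * a + logV' g * b)) :=
    hX.tr_congr (by rw [tr_deriv hd hu hv, map_add])
  rw [LinearMap.sub_apply, LinearMap.comp_apply, LinearMap.comp_apply, map_sub, h2] at h1
  rw [← tr_commutator_mul, ← tr_commutator_mul]
  simp only [map_add, map_sub, hX _ _, mul_add, mul_sub, mul_neg, map_neg] at h1 ⊢
  linear_combination (norm := module) h1

theorem logU'_mul_logU' (f g : A) : uInv * (logU f * logU g) * u = logU' f * logU' g := by
  simp only [logU', mul_assoc, u_mul_uInv_mul]

theorem logV'_mul_logV' (f g : A) : vInv * (logV f * logV g) * v = logV' f * logV' g := by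
  simp only [logV', mul_assoc, v_mul_vInv_mul]

/-- After `tr_deriv_ham_aux`, `d` hits only unprimed logarithmic derivatives and the expression is
antisymmetric in `f` and `g`, as needed to cancel against `tr_deriv_ham_expand`. -/
theorem tr_deriv_ham {d : A →ₗ[ℂ] A} (hd : IsDeriv d) {a b : A} (hu : d u = u * a)
    (hv : d v = v * b) (f g : A) :
    tr (d (ham f g)) =
      tr (logU' f * logU' g * a) - tr (logU' g * logU' f * a) -
        (tr (logV' f * logV' g * b) - tr (logV' g * logV' f * b)) -
        tr (logU' f * d (logV g)) + tr (logV' f * d (logU g)) +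
        tr (logU' g * d (logV f)) - tr (logV' g * d (logU f)) := by
  have h1 : tr (ham f g) = tr (logU' g * logV f - logV' g * logU f) := by
    rw [tr_ham, map_sub]
  rw [hd.tr_congr h1, ← tr_deriv_ham_aux hd hu hv f g]
  simp only [map_sub, hd _ _, map_add]
  abel

/-- The Hamiltonian derivation of a bracket is the commutator of the Hamiltonian derivations. -/
theorem ham_commutator (f g : A) : ham f ∘ₗ ham g - ham g ∘ₗ ham f = ham (ham f g) := by
  have hc := (isDeriv_ham f).commutator (isDeriv_ham g)
  obtain ⟨P, hP⟩ : ∃ P, P = ham f (logU g) - ham g (logU f) -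
    (logU f * logU g - logU g * logU f) := ⟨_, rfl⟩
  obtain ⟨Q, hQ⟩ : ∃ Q, Q = ham f (logV g) - ham g (logV f) +
    (logV f * logV g - logV g * logV f) := ⟨_, rfl⟩
  have hcu : (ham f ∘ₗ ham g - ham g ∘ₗ ham f) u = u * Q := by
    simp only [LinearMap.sub_apply, LinearMap.comp_apply, ham_u, isDeriv_ham _ _ _, hQ]
    noncomm_ring
  have hcv : (ham f ∘ₗ ham g - ham g ∘ₗ ham f) v = v * -P := by
    simp only [LinearMap.sub_apply, LinearMap.comp_apply, ham_v, isDeriv_ham _ _ _, hP, map_neg]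
    noncomm_ring
  -- `a` and `b` are the components of an arbitrary derivation `d`, so this compares the two sides
  -- as differentials.
  have key : ∀ a b, tr (uInv * P * u * a) + tr (vInv * Q * v * b) =
      tr (logU' (ham f g) * a) + tr (logV' (ham f g) * b) := by
    intro a b
    obtain ⟨d, hd, hu, hv⟩ := exists_isDeriv (u * a) (v * b)
    rw [← tr_deriv hd hu hv]
    have hfg := tr_deriv_ham hd hu hv f g
    have s : tr (d (ham f g)) = - tr (d (ham g f)) := by
      rw [← map_neg, ← map_neg]
      exact hd.tr_congr (by rw [map_neg, tr_ham_skew])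
    have t1 := tr_deriv_ham_expand hd hu hv f g
    have t2 := tr_deriv_ham_expand hd hu hv g f
    have pu : uInv * P * u = ham f (logU' g) - (logU' g * logV f - logV f * logU' g) -
        (ham g (logU' f) - (logU' f * logV g - logV g * logU' f)) -
        (logU' f * logU' g - logU' g * logU' f) := by
      rw [hP, (isDeriv_ham f).map_logU' (ham_u f), (isDeriv_ham g).map_logU' (ham_u g),
        ← logU'_mul_logU', ← logU'_mul_logU']
      noncomm_ring
    have qv : vInv * Q * v = ham f (logV' g) + (logV' g * logU f - logU f * logV' g) -
        (ham g (logV' f) + (logV' f * logU g - logU g * logV' f)) +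
        (logV' f * logV' g - logV' g * logV' f) := by
      rw [hQ, (isDeriv_ham f).map_logV' (ham_v f), (isDeriv_ham g).map_logV' (ham_v g),
        ← logV'_mul_logV', ← logV'_mul_logV']
      noncomm_ring
    rw [pu, qv]
    simp only [sub_mul, add_mul, map_sub, map_add]
    -- With T = tr d{f, g}, the expansion for (f, g) minus that for (g, f) is 2T by skew-symmetry;
    -- subtracting `hfg` leaves T and removes every term in which `d` is applied to a logarithmic
    -- derivative.
    linear_combination (norm := module) t2 - t1 + hfg - s
  have hPu : uInv * P * u = logU' (ham f g) := eq_of_tr_mul_eq fun a => by simpa using key a 0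
  have hQv : vInv * Q * v = logV' (ham f g) := eq_of_tr_mul_eq fun b => by simpa using key 0 b
  have hP' : P = logU (ham f g) := by
    have := congrArg (u * · * uInv) hPu
    simpa only [logU', mul_assoc, u_mul_uInv_mul, u_mul_uInv, mul_one] using this
  have hQ' : Q = logV (ham f g) := by
    have := congrArg (v * · * vInv) hQv
    simpa only [logV', mul_assoc, v_mul_vInv_mul, v_mul_vInv, mul_one] using this
  refine hc.ext (isDeriv_ham _) ?_ ?_
  · rw [hcu, hQ', ham_u]
  · rw [hcv, hP', ham_v]

/-! ### Descent to the cyclic space -/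

theorem commutant_le_ker_ham : commutant A ≤ LinearMap.ker ham := by
  refine Submodule.span_le.2 ?_
  rintro _ ⟨x, y, rfl⟩
  simp [ham_mul_comm x y]

/-- The bracket `A/[A,A] × A → A`. -/
def cyclicHam : CyclicSpace A →ₗ[ℂ] A →ₗ[ℂ] A :=
  (commutant A).liftQ ham commutant_le_ker_ham

theorem cyclicHam_tr (a : A) : cyclicHam (tr a) = ham a := rfl

/-- The bracket on `A/[A,A]`. -/
def cyclicBracket : CyclicSpace A →ₗ[ℂ] CyclicSpace A →ₗ[ℂ] CyclicSpace A :=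
  ((commutant A).liftQ (cyclicHam.compr₂ tr).flip (by
    refine Submodule.span_le.2 ?_
    rintro _ ⟨x, y, rfl⟩
    refine LinearMap.mem_ker.2 (LinearMap.ext fun f => ?_)
    obtain ⟨h, rfl⟩ := tr_surjective f
    have := (isDeriv_ham h).tr_congr (tr_mul_comm x y)
    simp [cyclicHam_tr, this])).flip

theorem cyclicBracket_tr (f : CyclicSpace A) (a : A) :
    cyclicBracket f (tr a) = tr (cyclicHam f a) := rfl

theorem isLeftLodayBracket_cyclicHam : IsLeftLodayBracket A cyclicHam where
  leibniz f a b := by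
    obtain ⟨h, rfl⟩ := tr_surjective f
    exact isDeriv_ham h a b
  exists_cyclic := by
    refine ⟨cyclicBracket, cyclicBracket_tr, fun f g => ?_, fun f g h => ?_, fun f g x => ?_⟩
    · obtain ⟨f, rfl⟩ := tr_surjective f
      obtain ⟨g, rfl⟩ := tr_surjective g
      exact tr_ham_skew f g
    · obtain ⟨f, rfl⟩ := tr_surjective f
      obtain ⟨g, rfl⟩ := tr_surjective g
      obtain ⟨h, rfl⟩ := tr_surjective h
      simp only [cyclicBracket_tr, cyclicHam_tr]
      -- The Jacobi identity is the trace of `ham_commutator`, once skew-symmetry has reordered two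
      -- of its three terms.
      have h1 := congrArg tr (LinearMap.congr_fun (ham_commutator f g) h)
      have h2 : tr (ham g (ham h f)) = -tr (ham g (ham f h)) := by
        rw [← map_neg]
        rw [← map_neg]
        exact (isDeriv_ham g).tr_congr (by rw [map_neg, tr_ham_skew])
      rw [LinearMap.sub_apply, map_sub] at h1
      rw [h2, tr_ham_skew h, ← h1]
      simp only [LinearMap.comp_apply]
      abel
    · obtain ⟨f, rfl⟩ := tr_surjective f
      obtain ⟨g, rfl⟩ := tr_surjective g
      simp only [cyclicBracket_tr, cyclicHam_tr]
      exact LinearMap.congr_fun (ham_commutator f g) x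

end

end Kontsevich

theorem mainTheorem1 :
    -- the double bracket is the unique one with the prescribed values and Leibniz rules
    (∀ D, Kontsevich.IsDoubleBracket D ↔ D = Kontsevich.doubleBracket) ∧
    -- (1) bilinearity, and extension to the tensor product
    (∀ b : Kontsevich.A, IsLinearMap ℂ (fun a => Kontsevich.bracket a b)) ∧
    (∀ a : Kontsevich.A, IsLinearMap ℂ (fun b => Kontsevich.bracket a b)) ∧
    (∃! B : Kontsevich.A ⊗[ℂ] Kontsevich.A →ₗ[ℂ] Kontsevich.A,
      ∀ a b : Kontsevich.A, B (a ⊗ₜ b) = Kontsevich.bracket a b) ∧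
    -- (2a) Leibniz rule in the second argument
    (∀ a b c : Kontsevich.A, Kontsevich.bracket a (b * c) =
      Kontsevich.bracket a b * c + b * Kontsevich.bracket a c) ∧
    -- (2b) invariance under cyclic permutations in the first argument
    (∀ a b c : Kontsevich.A, Kontsevich.bracket (a * b) c = Kontsevich.bracket (b * a) c) ∧
    -- (3) skew-symmetry modulo the commutant
    (∀ a b : Kontsevich.A,
      Kontsevich.bracket a b + Kontsevich.bracket b a ∈ Kontsevich.commutant Kontsevich.A) ∧
    -- (4) Jacobi identity of Loday type
    (∀ H₁ H₂ x : Kontsevich.A,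
      Kontsevich.bracket H₁ (Kontsevich.bracket H₂ x) -
        Kontsevich.bracket H₂ (Kontsevich.bracket H₁ x) =
      Kontsevich.bracket (Kontsevich.bracket H₁ H₂) x) ∧
    -- the bracket descends to a left Loday bracket on `A/[A,A] × A`
    (∃! B : Kontsevich.CyclicSpace Kontsevich.A →ₗ[ℂ] Kontsevich.A →ₗ[ℂ] Kontsevich.A,
      (∀ a b : Kontsevich.A,
        B (Kontsevich.cyclicProj Kontsevich.A a) b = Kontsevich.bracket a b) ∧
      Kontsevich.IsLeftLodayBracket Kontsevich.A B) := by
  refine ⟨fun D => ⟨fun h => h.unique Kontsevich.doubleBracket_spec,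
    fun h => h ▸ Kontsevich.doubleBracket_spec⟩,
    fun b => (Kontsevich.ham.flip b).isLinear, fun a => (Kontsevich.ham a).isLinear,
    ⟨TensorProduct.lift Kontsevich.ham, fun a b => rfl, fun B hB => TensorProduct.ext' hB⟩,
    Kontsevich.isDeriv_ham,
    fun a b c => LinearMap.congr_fun (Kontsevich.ham_mul_comm a b) c, fun a b => ?_,
    fun f g x => LinearMap.congr_fun (Kontsevich.ham_commutator f g) x,
    ⟨Kontsevich.cyclicHam, ⟨fun a b => rfl, Kontsevich.isLeftLodayBracket_cyclicHam⟩, ?_⟩⟩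
  · rw [← Kontsevich.tr_eq_zero_iff, map_add]
    exact add_eq_zero_iff_eq_neg.2 (Kontsevich.tr_ham_skew a b)
  · rintro B ⟨hB, -⟩
    refine LinearMap.ext fun f => LinearMap.ext fun b => ?_
    obtain ⟨a, rfl⟩ := Kontsevich.tr_surjective f
    exact hB a b
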